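/- Let $(X,\mathcal{F},m)$ be a non-atomic Lebesgue probability space, i.e. a probability space without points of positive measure which, up to completion and null sets, is isomorphic to a standard Borel space with a Borel measure. Let $T:X\to X$ be an ergodic automorphism, i.e. a bijection, measurable with measurable inverse, that preserves $m$ and is ergodic. Let $\mathcal{A}$ be the abelian group of measurable sets modulo $m$-null sets, with symmetric difference $A+B=A\,\triangle\,B$ as addition, and with the metric $d(A,B)=m(A+B)$. Let $\mathcal{B}=\{T(B)+B : B\in\mathcal{A}\}\subset\mathcal{A}$ be the subgroup of coboundaries and let $\mathcal{H}=\mathcal{A}/\mathcal{B}$ be the first cohomology group of $T$ with coefficients in $\mathbb{Z}_2$. Then $(\mathcal{A},d)$ is a Polish space, $\mathcal{B}$ is meager in $\mathcal{A}$, and $\mathcal{H}$ is uncountable. -/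

import Mathlib

open MeasureTheory
open scoped symmDiff

universe u

/-- `f : X → Y` and `g : Y → X` are mutually inverse isomorphisms modulo null sets between the
completions of the measure spaces `(X, m)` and `(Y, μ)`. -/
structure IsIsoModNull {X Y : Type*} [MeasurableSpace X] [MeasurableSpace Y]
    (m : Measure X) (μ : Measure Y) (f : X → Y) (g : Y → X) : Prop where
  nullMeasurable_toFun : NullMeasurable f m
  nullMeasurable_invFun : NullMeasurable g μ
  measure_preimage_toFun : ∀ B : Set Y, MeasurableSet B → m (f ⁻¹' B) = μ B
  measure_preimage_invFun : ∀ A : Set X, MeasurableSet A → μ (g ⁻¹' A) = m A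
  left_inv : ∀ᵐ x ∂m, g (f x) = x
  right_inv : ∀ᵐ y ∂μ, f (g y) = y

/-- `(X, m)` is a Lebesgue space (standard measure space): up to completion and null sets, it is
isomorphic to a Borel measure on a standard Borel space. Both Borel measures on standard Borel
spaces and their completions are covered. -/
def IsLebesgueSpace {X : Type u} [MeasurableSpace X] (m : Measure X) : Prop :=
  ∃ (Y : Type u) (_ : MeasurableSpace Y) (_ : StandardBorelSpace Y) (μ : Measure Y)
    (f : X → Y) (g : Y → X), IsIsoModNull m μ f g

theorem isLebesgueSpace_of_standardBorelSpace {X : Type u} [MeasurableSpace X]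
    [StandardBorelSpace X] (m : Measure X) : IsLebesgueSpace m :=
  ⟨X, inferInstance, inferInstance, m, id, id,
    measurable_id.nullMeasurable, measurable_id.nullMeasurable,
    fun _ _ => rfl, fun _ _ => rfl, .of_forall fun _ => rfl, .of_forall fun _ => rfl⟩

noncomputable section

namespace MeasureTheory.MeasuredSets

variable {X : Type u} [MeasurableSpace X] {m : Measure X}

/-- Addition of measurable sets is the symmetric difference. -/
instance : Add (MeasuredSets m) := ⟨fun s t => ⟨(s : Set X) ∆ t, s.2.symmDiff t.2⟩⟩

instance : Zero (MeasuredSets m) := ⟨⟨∅, MeasurableSet.empty⟩⟩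

instance : Neg (MeasuredSets m) := ⟨fun s => s⟩

theorem coe_add (s t : MeasuredSets m) : ((s + t : MeasuredSets m) : Set X) = (s : Set X) ∆ t := rfl

theorem coe_zero : ((0 : MeasuredSets m) : Set X) = ∅ := rfl

theorem coe_neg (s : MeasuredSets m) : ((-s : MeasuredSets m) : Set X) = s := rfl

instance : AddCommGroup (MeasuredSets m) where
  add_assoc s t u := SetLike.coe_injective (symmDiff_assoc (s : Set X) t u)
  zero_add s := SetLike.coe_injective (bot_symmDiff (s : Set X))
  add_zero s := SetLike.coe_injective (symmDiff_bot (s : Set X))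
  neg_add_cancel s := SetLike.coe_injective (symmDiff_self (s : Set X))
  add_comm s t := SetLike.coe_injective (symmDiff_comm (s : Set X) t)
  nsmul := nsmulRec
  zsmul := zsmulRec

theorem edist_add_add_le (s t s' t' : MeasuredSets m) :
    edist (s + t) (s' + t') ≤ edist s s' + edist t t' := by
  simp only [edist_def, coe_add]
  rw [symmDiff_symmDiff_symmDiff_comm]
  refine (measure_mono ?_).trans (measure_union_le _ _)
  exact symmDiff_le_sup

instance : IsTopologicalAddGroup (MeasuredSets m) where
  continuous_add := by
    refine (EMetric.continuous_iff).2 fun p ε hε => ?_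
    refine ⟨ε / 2, ENNReal.half_pos hε.ne', fun q hq => ?_⟩
    calc edist (q.1 + q.2) (p.1 + p.2) ≤ edist q.1 p.1 + edist q.2 p.2 := edist_add_add_le _ _ _ _
      _ < ε / 2 + ε / 2 := ENNReal.add_lt_add (lt_of_le_of_lt (le_max_left _ _) hq)
          (lt_of_le_of_lt (le_max_right _ _) hq)
      _ = ε := ENNReal.add_halves ε
  continuous_neg := continuous_id

end MeasureTheory.MeasuredSets

/-- The group of cocycles `𝒜`: measurable sets modulo null sets, with symmetric difference as
addition and the topology of the distance `d(A, B) = m (A ∆ B)`. The separation quotient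
identifies `A` and `B` exactly when `d(A, B) = 0`. -/
abbrev CocycleGroup {X : Type u} [MeasurableSpace X] (m : Measure X) : Type u :=
  SeparationQuotient (MeasuredSets m)

/-- The coboundary map `B ↦ T(B) + B` on measurable sets. -/
def coboundaryMap {X : Type u} [MeasurableSpace X] (m : Measure X) (T : X ≃ᵐ X) :
    MeasuredSets m →+ MeasuredSets m where
  toFun B := ⟨T '' (B : Set X), T.measurableSet_image.2 B.2⟩ + B
  map_zero' := SetLike.coe_injective (by
    change (T '' (∅ : Set X)) ∆ (∅ : Set X) = ∅
    simp)
  map_add' A B := SetLike.coe_injective (by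
    simp only [MeasuredSets.coe_add]
    change (T '' ((A : Set X) ∆ B)) ∆ ((A : Set X) ∆ B)
      = ((T '' (A : Set X)) ∆ A) ∆ ((T '' (B : Set X)) ∆ B)
    rw [Set.image_symmDiff T.injective, symmDiff_symmDiff_symmDiff_comm])

/-- The group of coboundaries `ℬ`: the classes of the sets `T(B) + B`, `B` measurable. -/
def coboundaryGroup {X : Type u} [MeasurableSpace X] (m : Measure X) (T : X ≃ᵐ X) :
    AddSubgroup (CocycleGroup m) :=
  ((SeparationQuotient.mkAddMonoidHom (M := MeasuredSets m)).comp (coboundaryMap m T)).range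

/-- The first cohomology group `ℋ = 𝒜 / ℬ` of `T` with coefficients in `ℤ/2`. -/
abbrev CohomologyGroup {X : Type u} [MeasurableSpace X] (m : Measure X) (T : X ≃ᵐ X) : Type u :=
  CocycleGroup m ⧸ coboundaryGroup m T

end

open Set Filter Topology
open scoped ENNReal

section OpenMapping

variable {G H : Type*} [AddCommGroup G] [PseudoEMetricSpace G] [IsIsometricVAdd G G]
  [AddCommGroup H] [PseudoEMetricSpace H] [IsIsometricVAdd H H]

theorem edist_sub_sub_le_add (a b c d : G) :
    edist (a - b) (c - d) ≤ edist a c + edist b d := by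
  refine (edist_triangle _ (c - b) _).trans ?_
  rw [edist_sub_right, edist_sub_left]

theorem edist_sub_zero (a b : G) : edist (a - b) 0 = edist a b := by
  rw [← sub_self b, edist_sub_right]

/-- If the range of a homomorphism from a separable group is not meagre, then the closure of the
image of every ball around zero is a neighborhood of zero. -/
theorem AddMonoidHom.exists_approx_preimage_of_not_isMeagre_range
    [TopologicalSpace.SeparableSpace G] (φ : G →+ H)
    (h : ¬ IsMeagre (Set.range φ)) {ε : ℝ≥0∞} (hε : 0 < ε) :
    ∃ δ > 0, ∀ y : H, edist y 0 < δ → ∀ η > 0, ∃ g : G, edist g 0 < ε ∧ edist y (φ g) < η := by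
  obtain ⟨s, hs, hsd⟩ := TopologicalSpace.exists_countable_dense G
  have hcov : Set.range φ ⊆ ⋃ a ∈ s, φ '' Metric.eball a (ε / 2) := by
    rintro _ ⟨g, rfl⟩
    obtain ⟨a, ha, has⟩ := EMetric.dense_iff.1 hsd g (ε / 2) (ENNReal.half_pos hε.ne')
    refine mem_iUnion₂.2 ⟨a, has, g, ?_, rfl⟩
    rwa [Metric.mem_eball, edist_comm]
  obtain ⟨a, -, ha⟩ := exists_of_not_isMeagre_biUnion hs fun hm => h (hm.mono hcov)
  obtain ⟨z, hz⟩ : (interior (closure (φ '' Metric.eball a (ε / 2)))).Nonempty := by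
    rw [nonempty_iff_ne_empty]
    exact fun h0 => ha (IsNowhereDense.isMeagre h0)
  obtain ⟨δ, hδ, hball⟩ := EMetric.isOpen_iff.1 isOpen_interior z hz
  refine ⟨δ, hδ, fun y hy η hη => ?_⟩
  have key : ∀ w ∈ interior (closure (φ '' Metric.eball a (ε / 2))),
      ∃ g, edist g a < ε / 2 ∧ edist w (φ g) < η / 2 := by
    intro w hw
    obtain ⟨_, ⟨g, hg, rfl⟩, hwg⟩ :=
      EMetric.mem_closure_iff.1 (interior_subset hw) (η / 2) (ENNReal.half_pos hη.ne')
    exact ⟨g, hg, hwg⟩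
  obtain ⟨g₁, hg₁, hw₁⟩ := key (y + z) (hball (by
    rw [Metric.mem_eball, ← edist_sub_zero, add_sub_cancel_right]; exact hy))
  obtain ⟨g₂, hg₂, hw₂⟩ := key z hz
  refine ⟨g₁ - g₂, ?_, ?_⟩
  · rw [edist_sub_zero, ← ENNReal.add_halves ε]
    exact (edist_triangle_right _ _ a).trans_lt (ENNReal.add_lt_add hg₁ hg₂)
  · rw [← ENNReal.add_halves η, map_sub]
    nth_rewrite 1 [← add_sub_cancel_right y z]
    exact (edist_sub_sub_le_add _ _ _ _).trans_lt (ENNReal.add_lt_add hw₁ hw₂)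

/-- An open mapping theorem: if the range of a continuous homomorphism from a complete separable
group is not meagre, then the image of every ball around zero is a neighborhood of zero. -/
theorem AddMonoidHom.exists_preimage_of_not_isMeagre_range
    [CompleteSpace G] [TopologicalSpace.SeparableSpace G] [T2Space H] (φ : G →+ H)
    (hφ : Continuous φ) (h : ¬ IsMeagre (Set.range φ)) {ε : ℝ≥0∞} (hε : 0 < ε) (hε' : ε ≠ ∞) :
    ∃ δ > 0, ∀ y : H, edist y 0 < δ → ∃ g : G, edist g 0 ≤ 2 * ε ∧ φ g = y := by
  have hε2 : ∀ n : ℕ, 0 < ε / 2 ^ n := fun n =>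
    ENNReal.div_pos hε.ne' (ENNReal.pow_ne_top ENNReal.ofNat_ne_top)
  choose δ hδ hδφ using fun n : ℕ => φ.exists_approx_preimage_of_not_isMeagre_range h (hε2 n)
  refine ⟨δ 0, hδ 0, fun y hy => ?_⟩
  have step : ∀ (n : ℕ) (s : G), edist y (φ s) < δ n →
      ∃ s', edist s s' ≤ ε / 2 ^ n ∧ edist y (φ s') < min (δ (n + 1)) (2⁻¹ ^ n) := by
    intro n s hs
    obtain ⟨g, hg, hyg⟩ := hδφ n (y - φ s) (by rwa [edist_sub_zero])
      (min (δ (n + 1)) (2⁻¹ ^ n)) (lt_min (hδ _) (ENNReal.pow_pos (by simp) n))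
    refine ⟨g + s, ?_, ?_⟩
    · rw [edist_comm, ← edist_sub_zero, add_sub_cancel_right]
      exact hg.le
    · rwa [← edist_sub_right _ _ (φ s), map_add, add_sub_cancel_right]
  choose! nxt hnxt hnxt' using step
  let s : ℕ → G := fun n => Nat.rec 0 (fun n g => nxt n g) n
  have hs : ∀ n, edist y (φ (s n)) < δ n := by
    intro n
    induction n with
    | zero => simpa [s] using hy
    | succ n ih => exact (hnxt' n _ ih).trans_le (min_le_left _ _)
  have hss : ∀ n, edist (s n) (s (n + 1)) ≤ ε / 2 ^ n := fun n => hnxt n _ (hs n)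
  have hsy : ∀ n, edist (φ (s (n + 1))) y ≤ 2⁻¹ ^ n := fun n => by
    rw [edist_comm]
    exact ((hnxt' n _ (hs n)).trans_le (min_le_right _ _)).le
  obtain ⟨g, hg⟩ := cauchySeq_tendsto_of_complete (cauchySeq_of_edist_le_geometric_two ε hε' hss)
  refine ⟨g, ?_, ?_⟩
  · rw [edist_comm]
    exact edist_le_of_edist_le_geometric_two_of_tendsto₀ ε hss hg
  · refine tendsto_nhds_unique (((hφ.tendsto g).comp hg).comp (tendsto_add_atTop_nat 1)) ?_
    rw [tendsto_iff_edist_tendsto_0]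
    exact tendsto_of_tendsto_of_tendsto_of_le_of_le tendsto_const_nhds
      (ENNReal.tendsto_pow_atTop_nhds_zero_of_lt_one (by simp)) (fun _ => zero_le) hsy

end OpenMapping

namespace MeasureTheory.MeasuredSets

variable {X : Type u} [MeasurableSpace X] {m : Measure X}

theorem edist_zero_right (s : MeasuredSets m) : edist s 0 = m s := by
  rw [edist_def, coe_zero, ← bot_eq_empty, symmDiff_bot]

instance : IsIsometricVAdd (MeasuredSets m) (MeasuredSets m) where
  isometry_vadd c s t := by
    simp only [vadd_eq_add, edist_def, coe_add]
    rw [symmDiff_symmDiff_symmDiff_comm, symmDiff_self, bot_symmDiff]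

instance : CompleteSpace (MeasuredSets m) := by
  refine EMetric.complete_of_convergent_controlled_sequences (fun n => 2⁻¹ ^ n)
    (fun n => ENNReal.pow_pos (by simp) n) fun u hu => ?_
  have hlim : MeasurableSet (limsup (fun n => (u n : Set X)) atTop) :=
    .measurableSet_limsup fun n => (u n).2
  let v : MeasuredSets m := ⟨_, hlim⟩
  have hmem : ∀ x, x ∈ (v : Set X) ↔ ∃ᶠ n in atTop, x ∈ (u n : Set X) := fun x => by
    rw [← mem_limsup_iff_frequently_mem]; rfl
  have hsub : ∀ n, (u n : Set X) ∆ v ⊆ ⋃ k, (u (n + k) : Set X) ∆ u (n + k + 1) := by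
    intro n x hx
    by_contra hcon
    simp only [mem_iUnion, not_exists, mem_symmDiff] at hcon
    have hconst : ∀ k, x ∈ (u (n + k) : Set X) ↔ x ∈ (u n : Set X) := by
      intro k
      induction k with
      | zero => rfl
      | succ k ih => rw [← ih, ← add_assoc]; have := hcon k; tauto
    have hv : x ∈ (v : Set X) ↔ x ∈ (u n : Set X) := by
      rw [hmem]
      have he : ∀ᶠ k in atTop, x ∈ (u k : Set X) ↔ x ∈ (u n : Set X) := by
        filter_upwards [eventually_ge_atTop n] with k hk
        obtain ⟨j, rfl⟩ := Nat.exists_eq_add_of_le hk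
        exact hconst j
      rw [frequently_congr he, frequently_const]
    rw [mem_symmDiff] at hx
    tauto
  have hle : ∀ n, edist (u n) v ≤ 2 * 2⁻¹ ^ n := fun n => by
    calc edist (u n) v ≤ ∑' k, m ((u (n + k) : Set X) ∆ u (n + k + 1)) :=
          (measure_mono (hsub n)).trans (measure_iUnion_le _)
      _ ≤ ∑' k, 2⁻¹ ^ (n + k) :=
          ENNReal.tsum_le_tsum fun k => (hu (n + k) _ _ le_rfl (Nat.le_succ _)).le
      _ = 2 * 2⁻¹ ^ n := by
          simp_rw [pow_add, ENNReal.tsum_mul_left, ENNReal.tsum_geometric, ENNReal.one_sub_inv_two,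
            inv_inv, mul_comm]
  refine ⟨v, tendsto_iff_edist_tendsto_0.2 ?_⟩
  refine tendsto_of_tendsto_of_tendsto_of_le_of_le tendsto_const_nhds ?_ (fun _ => zero_le) hle
  simpa using ENNReal.Tendsto.const_mul (a := 2)
    (ENNReal.tendsto_pow_atTop_nhds_zero_of_lt_one (r := 2⁻¹) (by simp)) (by simp)

end MeasureTheory.MeasuredSets

instance {X : Type u} [MeasurableSpace X] {m : Measure X} :
    IsIsometricVAdd (CocycleGroup m) (CocycleGroup m) where
  isometry_vadd c s t := by
    obtain ⟨c, rfl⟩ := SeparationQuotient.surjective_mk c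
    obtain ⟨s, rfl⟩ := SeparationQuotient.surjective_mk s
    obtain ⟨t, rfl⟩ := SeparationQuotient.surjective_mk t
    simp only [vadd_eq_add, ← SeparationQuotient.mk_add, SeparationQuotient.edist_mk]
    exact edist_add_left c s t

namespace IsIsoModNull

variable {X Y : Type*} [MeasurableSpace X] [MeasurableSpace Y] {m : Measure X} {μ : Measure Y}
  {f : X → Y} {g : Y → X}

theorem isFiniteMeasure [IsFiniteMeasure m] (h : IsIsoModNull m μ f g) : IsFiniteMeasure μ :=
  ⟨by rw [← h.measure_preimage_toFun _ .univ]; exact measure_lt_top _ _⟩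

theorem preimage_null (h : IsIsoModNull m μ f g) {s : Set Y} (hs : μ s = 0) :
    m (f ⁻¹' s) = 0 := by
  refine measure_mono_null (preimage_mono (subset_toMeasurable μ s)) ?_
  rw [h.measure_preimage_toFun _ (measurableSet_toMeasurable μ s), measure_toMeasurable, hs]

theorem preimage_ae_eq (h : IsIsoModNull m μ f g) {s t : Set Y} (hst : s =ᵐ[μ] t) :
    f ⁻¹' s =ᵐ[m] f ⁻¹' t := by
  rw [← measure_symmDiff_eq_zero_iff] at hst ⊢
  exact h.preimage_null hst

theorem exists_measurableSet_preimage_ae_eq (h : IsIsoModNull m μ f g) {s : Set X}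
    (hs : MeasurableSet s) : ∃ t, MeasurableSet t ∧ f ⁻¹' t =ᵐ[m] s := by
  have hnull : NullMeasurableSet (g ⁻¹' s) μ := h.nullMeasurable_invFun hs
  refine ⟨toMeasurable μ (g ⁻¹' s), measurableSet_toMeasurable _ _,
    (h.preimage_ae_eq hnull.toMeasurable_ae_eq).trans ?_⟩
  filter_upwards [h.left_inv] with x hx
  change (g (f x) ∈ s) = (x ∈ s)
  rw [hx]

theorem nullSingletonClass [NullSingletonClass m] [MeasurableSingletonClass Y]
    (h : IsIsoModNull m μ f g) : NullSingletonClass μ where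
  measure_singleton y := by
    rw [← h.measure_preimage_toFun _ (measurableSet_singleton y)]
    have hg : ∀ᵐ x ∂m, x ≠ g y := by
      rw [ae_iff]
      simp
    rw [measure_eq_zero_iff_ae_notMem]
    filter_upwards [h.left_inv, hg] with x hx hxg hxy
    exact hxg (by rw [← hx, show f x = y from hxy])

end IsIsoModNull

theorem exists_measurableSet_measure_pos_lt {Y : Type*} [MeasurableSpace Y] [StandardBorelSpace Y]
    (μ : Measure Y) [IsFiniteMeasure μ] [NullSingletonClass μ] (hμ : μ ≠ 0) {ε : ℝ≥0∞}
    (hε : 0 < ε) : ∃ s, MeasurableSet s ∧ 0 < μ s ∧ μ s < ε := by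
  let := upgradeStandardBorel Y
  have hnhds : ∀ y : Y, ∃ U, IsOpen U ∧ y ∈ U ∧ μ U < ε := fun y => by
    obtain ⟨U, hyU, hU, hlt⟩ := ({y} : Set Y).exists_isOpen_lt_of_lt (μ := μ) ε
      (by rwa [measure_singleton])
    exact ⟨U, hU, by simpa using hyU, hlt⟩
  choose U hU hyU hUε using hnhds
  obtain ⟨t, ht, hcov⟩ := TopologicalSpace.countable_cover_nhds
    fun y => (hU y).mem_nhds (hyU y)
  by_contra! hcon
  refine hμ (Measure.measure_univ_eq_zero.1 ?_)
  rw [← hcov, measure_biUnion_null_iff ht]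
  intro y _
  by_contra hy
  exact (hcon _ (hU y).measurableSet (pos_iff_ne_zero.2 hy)).not_gt (hUε y)

namespace IsLebesgueSpace

variable {X : Type u} [MeasurableSpace X] {m : Measure X}

theorem separableSpace_measuredSets [IsFiniteMeasure m] (h : IsLebesgueSpace m) :
    TopologicalSpace.SeparableSpace (MeasuredSets m) := by
  obtain ⟨Y, _, _, μ, f, g, hfg⟩ := h
  have := hfg.isFiniteMeasure
  obtain ⟨C, hC, hCd⟩ := exists_countable_measureDense μ
  let q : Set Y → MeasuredSets m := fun t =>
    ⟨toMeasurable m (f ⁻¹' t), measurableSet_toMeasurable _ _⟩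
  refine ⟨q '' C, hC.image q, EMetric.dense_iff.2 fun s ε hε => ?_⟩
  obtain ⟨t, ht, hts⟩ := hfg.exists_measurableSet_preimage_ae_eq (s := (s : Set X)) s.2
  obtain ⟨r, hr, hrε⟩ : ∃ r : ℝ, 0 < r ∧ ENNReal.ofReal r ≤ ε := by
    obtain ⟨r, -, hr, hrε⟩ := ENNReal.lt_iff_exists_real_btwn.1 hε
    exact ⟨r, by simpa using hr, hrε.le⟩
  obtain ⟨c, hc, hct⟩ := hCd.approx t ht (measure_ne_top _ _) r hr
  refine ⟨q c, ?_, mem_image_of_mem _ hc⟩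
  have hcm := hCd.measurable c hc
  have hqc : (q c : Set X) =ᵐ[m] f ⁻¹' c :=
    NullMeasurableSet.toMeasurable_ae_eq (hfg.nullMeasurable_toFun hcm)
  have hdist : m ((s : Set X) ∆ q c) = μ (t ∆ c) := by
    rw [← hfg.measure_preimage_toFun _ (ht.symmDiff hcm), preimage_symmDiff]
    exact measure_congr (ae_eq_set_symmDiff hts.symm hqc)
  rw [Metric.mem_eball, edist_comm, MeasuredSets.edist_def, hdist]
  exact hct.trans_le hrε

theorem exists_measurableSet_measure_pos_lt [IsProbabilityMeasure m] [NullSingletonClass m]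
    (h : IsLebesgueSpace m) {ε : ℝ≥0∞} (hε : 0 < ε) :
    ∃ s, MeasurableSet s ∧ 0 < m s ∧ m s < ε := by
  obtain ⟨Y, _, _, μ, f, g, hfg⟩ := h
  have := hfg.isFiniteMeasure
  have := hfg.nullSingletonClass
  have hμ : μ ≠ 0 := fun h0 => by
    have := hfg.measure_preimage_toFun _ .univ
    simp [h0] at this
  obtain ⟨t, ht, ht0, htε⟩ := _root_.exists_measurableSet_measure_pos_lt μ hμ hε
  refine ⟨toMeasurable m (f ⁻¹' t), measurableSet_toMeasurable _ _, ?_⟩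
  rw [measure_toMeasurable, hfg.measure_preimage_toFun _ ht]
  exact ⟨ht0, htε⟩

theorem polishSpace_cocycleGroup [IsFiniteMeasure m] (h : IsLebesgueSpace m) :
    PolishSpace (CocycleGroup m) := by
  have := h.separableSpace_measuredSets
  have : TopologicalSpace.SeparableSpace (CocycleGroup m) :=
    SeparationQuotient.surjective_mk.denseRange.separableSpace SeparationQuotient.continuous_mk
  have : SecondCountableTopology (CocycleGroup m) :=
    UniformSpace.secondCountable_of_separable _
  infer_instance

end IsLebesgueSpace

section Coboundary

variable {X : Type u} [MeasurableSpace X] {m : Measure X} {T : X ≃ᵐ X}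

theorem measure_image_measurableEquiv (hT : MeasurePreserving T m m) (s : Set X) :
    m (T '' s) = m s := by
  rw [T.image_eq_preimage_symm, hT.symm.measure_preimage_equiv]

theorem coe_coboundaryMap (B : MeasuredSets m) :
    (coboundaryMap m T B : Set X) = (T '' (B : Set X)) ∆ B := rfl

theorem continuous_coboundaryMap (hT : MeasurePreserving T m m) :
    Continuous (coboundaryMap m T) := by
  refine Continuous.add (Isometry.continuous fun s t => ?_) continuous_id
  simp only [MeasuredSets.edist_def]
  exact (congrArg m (image_symmDiff T.injective (s : Set X) t).symm).trans
    (measure_image_measurableEquiv hT _)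

theorem measure_eq_zero_or_one_of_coboundaryMap_null [IsProbabilityMeasure m] (hT : Ergodic T m)
    {B : MeasuredSets m} (hB : m (coboundaryMap m T B) = 0) : m B = 0 ∨ m B = 1 := by
  rw [coe_coboundaryMap, measure_symmDiff_eq_zero_iff] at hB
  have hBm : MeasurableSet (B : Set X) := B.2
  rcases hT.ae_empty_or_univ_of_image_ae_le hBm.nullMeasurableSet hB.le with h | h
  · exact .inl (by rw [measure_congr h, measure_empty])
  · exact .inr (by rw [measure_congr h, measure_univ])

/-- An ergodic automorphism of a space with arbitrarily small sets of positive measure has almost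
invariant sets whose measure is bounded away from zero and one. -/
theorem exists_measure_coboundaryMap_lt [IsProbabilityMeasure m] (hT : Ergodic T m)
    (hm : ∀ ε : ℝ≥0∞, 0 < ε → ∃ s, MeasurableSet s ∧ 0 < m s ∧ m s < ε)
    {δ : ℝ≥0∞} (hδ : 0 < δ) :
    ∃ D : MeasuredSets m, 4⁻¹ ≤ m D ∧ m D ≤ 2⁻¹ ∧ m (coboundaryMap m T D) < δ := by
  obtain ⟨E, hE, hE0, hElt⟩ := hm (min (δ / 2) 4⁻¹) (lt_min (ENNReal.half_pos hδ.ne') (by simp))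
  have hEδ := hElt.trans_le (min_le_left _ _)
  have hE4 := hElt.trans_le (min_le_right _ _)
  let D : ℕ → Set X := fun n => Nat.rec ∅ (fun _ s => E ∪ T '' s) n
  have hDs : ∀ n, D (n + 1) = E ∪ T '' D n := fun n => rfl
  have hDm : ∀ n, MeasurableSet (D n) := by
    intro n
    induction n with
    | zero => exact .empty
    | succ n ih => exact hE.union (T.measurableSet_image.2 ih)
  have hDmono : Monotone D := by
    refine monotone_nat_of_le_succ fun n => ?_
    induction n with
    | zero => exact empty_subset _
    | succ n ih => exact union_subset_union_right _ (image_mono ih)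
  have hstep : ∀ n, m (D (n + 1)) ≤ m E + m (D n) := fun n => by
    rw [hDs]
    exact (measure_union_le _ _).trans_eq
      (by rw [measure_image_measurableEquiv hT.toMeasurePreserving])
  have hfull : m (⋃ n, D n) = 1 := by
    have hinv : T '' (⋃ n, D n) ⊆ ⋃ n, D n := by
      rw [image_iUnion]
      exact iUnion_subset fun n => subset_iUnion_of_subset (n + 1) subset_union_right
    rcases hT.ae_empty_or_univ_of_image_ae_le (MeasurableSet.iUnion hDm).nullMeasurableSet
      hinv.eventuallyLE with h | h
    · have hEU : E ⊆ ⋃ n, D n := subset_iUnion_of_subset 1 subset_union_left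
      exact absurd (measure_mono_null hEU (by rw [measure_congr h, measure_empty])) hE0.ne'
    · rw [measure_congr h, measure_univ]
  have hex : ∃ n, 4⁻¹ ≤ m (D n) := by
    have htend := tendsto_measure_iUnion_atTop (μ := m) hDmono
    rw [hfull] at htend
    exact ((htend.eventually (lt_mem_nhds (a := 4⁻¹) (by
      rw [ENNReal.inv_lt_one]; norm_num))).exists).imp fun n hn => le_of_lt hn
  classical
  obtain ⟨n, hn, hmin⟩ : ∃ n, 4⁻¹ ≤ m (D (n + 1)) ∧ m (D n) < 4⁻¹ := by
    have h0 : Nat.find hex ≠ 0 := fun h0 => by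
      have := Nat.find_spec hex
      rw [h0] at this
      simp [D] at this
    obtain ⟨n, hn⟩ := Nat.exists_eq_succ_of_ne_zero h0
    exact ⟨n, by have := Nat.find_spec hex; rwa [hn] at this,
      not_le.1 (Nat.find_min hex (by omega))⟩
  have h42 : (4⁻¹ + 4⁻¹ : ℝ≥0∞) = 2⁻¹ := by
    rw [← two_mul, show (4 : ℝ≥0∞) = 2 * 2 by norm_num, ENNReal.mul_inv (by simp) (by simp),
      ← mul_assoc, ENNReal.mul_inv_cancel (by simp) (by simp), one_mul]
  refine ⟨⟨D (n + 1), hDm (n + 1)⟩, hn, ?_, ?_⟩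
  · exact ((hstep n).trans (add_le_add hE4.le hmin.le)).trans_eq h42
  · have h1 : m (T '' D (n + 1) \ D (n + 1)) ≤ m E := by
      calc m (T '' D (n + 1) \ D (n + 1)) ≤ m (D (n + 2) \ D (n + 1)) :=
            measure_mono (sdiff_le_sdiff_right subset_union_right)
        _ = m (D (n + 2)) - m (D (n + 1)) :=
            measure_sdiff (hDmono (Nat.le_succ (n + 1))) (hDm (n + 1)).nullMeasurableSet
              (measure_ne_top _ _)
        _ ≤ m E := tsub_le_iff_right.2 (hstep (n + 1))
    have h2 : m (D (n + 1) \ T '' D (n + 1)) ≤ m E := by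
      refine measure_mono (sdiff_subset_iff.2 ?_)
      rw [union_comm]
      exact (hDmono (Nat.le_succ (n + 1))).trans_eq (hDs (n + 1))
    calc m ((T '' D (n + 1)) ∆ D (n + 1)) ≤ m E + m E :=
          (measure_union_le _ _).trans (add_le_add h1 h2)
      _ < δ / 2 + δ / 2 := ENNReal.add_lt_add hEδ hEδ
      _ = δ := ENNReal.add_halves δ

theorem isMeagre_coboundaryGroup [IsProbabilityMeasure m] [NullSingletonClass m]
    (hm : IsLebesgueSpace m) (hT : Ergodic T m) :
    IsMeagre (coboundaryGroup m T : Set (CocycleGroup m)) := by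
  have := hm.separableSpace_measuredSets
  let φ := (SeparationQuotient.mkAddMonoidHom (M := MeasuredSets m)).comp (coboundaryMap m T)
  by_contra hcon
  have hφ : Continuous φ :=
    SeparationQuotient.continuous_mk.comp (continuous_coboundaryMap hT.toMeasurePreserving)
  obtain ⟨δ, hδ, hδφ⟩ := φ.exists_preimage_of_not_isMeagre_range hφ
    (by rwa [← AddMonoidHom.coe_range]) (ε := 16⁻¹) (by simp) (by simp)
  obtain ⟨D, hD, hD', hDδ⟩ := exists_measure_coboundaryMap_lt hT
    (fun ε hε => hm.exists_measurableSet_measure_pos_lt hε) hδ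
  have hedist : ∀ B, edist (φ B) 0 = m (coboundaryMap m T B) := fun B => by
    rw [← MeasuredSets.edist_zero_right, ← SeparationQuotient.edist_mk]
    rfl
  obtain ⟨B, hB, hBD⟩ := hδφ (φ D) (by rwa [hedist])
  rw [MeasuredSets.edist_zero_right] at hB
  have hnull : m (coboundaryMap m T (B + D)) = 0 := by
    rw [← hedist, map_add, hBD, ← map_add, show D + D = 0 from neg_add_cancel D, map_zero,
      edist_self]
  have hle : m D ≤ m ((B + D : MeasuredSets m) : Set X) + m B := by
    have h := MeasuredSets.edist_add_add_le (B + D) B 0 0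
    rwa [add_zero, show B + D + B = D by
      rw [add_right_comm, show B + B = 0 from neg_add_cancel B, zero_add],
      MeasuredSets.edist_zero_right, MeasuredSets.edist_zero_right,
      MeasuredSets.edist_zero_right] at h
  have hge : m ((B + D : MeasuredSets m) : Set X) ≤ m B + m D := by
    simpa only [MeasuredSets.edist_zero_right, add_zero] using
      MeasuredSets.edist_add_add_le B D 0 0
  rcases measure_eq_zero_or_one_of_coboundaryMap_null hT hnull with h | h
  · rw [h, zero_add] at hle
    have hlt := (hD.trans hle).trans hB
    rw [← ENNReal.toReal_le_toReal (by finiteness) (by finiteness)] at hlt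
    norm_num at hlt
  · rw [h] at hge
    have hlt := hge.trans (add_le_add hB hD')
    rw [← ENNReal.toReal_le_toReal (by finiteness) (by finiteness),
      ENNReal.toReal_add (by finiteness) (by finiteness)] at hlt
    norm_num at hlt

theorem uncountable_cohomologyGroup (m : Measure X) (T : X ≃ᵐ X)
    (h : IsMeagre (coboundaryGroup m T : Set (CocycleGroup m))) :
    Uncountable (CohomologyGroup m T) := by
  by_contra hcon
  rw [not_uncountable_iff] at hcon
  have hfib : ∀ q : CohomologyGroup m T,
      IsMeagre ((QuotientAddGroup.mk : CocycleGroup m → CohomologyGroup m T) ⁻¹' {q}) := by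
    intro q
    obtain ⟨a, rfl⟩ := QuotientAddGroup.mk_surjective q
    refine ((Homeomorph.addLeft a).isInducing.isMeagre_image h).mono fun b hb => ?_
    exact ⟨-a + b, QuotientAddGroup.eq.1 (Eq.symm hb), add_neg_cancel_left a b⟩
  refine not_isMeagre_of_isOpen (X := CocycleGroup m) isOpen_univ univ_nonempty
    ((isMeagre_iUnion hfib).mono fun a _ => ?_)
  exact mem_iUnion.2 ⟨QuotientAddGroup.mk a, rfl⟩

end Coboundary

theorem mainTheorem1 {X : Type u} [MeasurableSpace X] (m : Measure X) [IsProbabilityMeasure m]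
    [NullSingletonClass m] (hm : IsLebesgueSpace m) (T : X ≃ᵐ X) (hT : Ergodic T m) :
    PolishSpace (CocycleGroup m) ∧
      IsMeagre (coboundaryGroup m T : Set (CocycleGroup m)) ∧
      Uncountable (CohomologyGroup m T) :=
  have hB := isMeagre_coboundaryGroup hm hT
  ⟨hm.polishSpace_cocycleGroup, hB, uncountable_cohomologyGroup m T hB⟩
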